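/- Let $(W,S)$ be a Coxeter system. For $I\subseteq S$ let $W_I$ be the subgroup of $W$ generated by $I$. A nonempty subset $I\subseteq S$ is called connected if $W_I$ is finite and $I$ cannot be written as $I=J\sqcup K$ with $J,K$ nonempty, disjoint and $W_I=W_J\times W_K$ (internal direct product). Let $\mathcal F(S)$ be the set of connected subsets of $S$, and for $I\in\mathcal F(S)$ let $w_I$ be the longest element of $W_I$. The generalized cactus group $C_W$ is the group generated by $\{\gamma_I : I\in\mathcal F(S)\}$ subject to the relations $\gamma_I^2=1$ for all $I\in\mathcal F(S)$, and $\gamma_I\gamma_J=\gamma_J\gamma_{w_J(I)}$ for all $I,J\in\mathcal F(S)$ with $I\subseteq J$ or $W_{I\cup J}=W_I\times W_J$, where $w_J(I)=w_JIw_J^{-1}$. Let $\mathbb S=\{wW_Iw^{-1} : w\in W,\ I\in\mathcal F(S)\}$, and let $\mathbb W$ be the right-angled Coxeter group with generators $\tau_{W'}$, $W'\in\mathbb S$, and Coxeter matrix $$m(W',W'')=\begin{cases}1 & \text{if } W'=W'',\\ 2 & \text{if } W'\subsetneq W'' \text{ or } W''\subsetneq W',\\ 2 & \text{if } W'\cap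 W''=\{1\} \text{ and } W'' \text{ centralizes } W',\\ \infty & \text{otherwise.}\end{cases}$$ **Theorem.** There is a (necessarily unique) group homomorphism $g_W\colon C_W\to W$ with $g_W(\gamma_I)=w_I$ for all $I\in\mathcal F(S)$, and its kernel, the generalized pure cactus group $PC_W=\ker g_W$, embeds into $\mathbb W$: there is an injective group homomorphism $PC_W\to\mathbb W$. -/

import Mathlib

namespace CoxeterSystem

/-- `L` is the internal direct product of its subgroups `H` and `K`, written `L = H × K`:
`H` and `K` intersect trivially, commute elementwise, and together generate `L`. -/
def IsInternalProd {W : Type*} [Group W] (L H K : Subgroup W) : Prop :=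
  H ⊓ K = ⊥ ∧ (∀ h ∈ H, ∀ k ∈ K, h * k = k * h) ∧ H ⊔ K = L

/-- The standard parabolic subgroup `W_I`, generated by the simple reflections in `I`. A set of
simple reflections is given by the set `I` of its indices. -/
def parabolic {B W : Type*} [Group W] {M : CoxeterMatrix B} (cs : CoxeterSystem M W)
    (I : Set B) : Subgroup W :=
  Subgroup.closure (cs.simple '' I)

/-- A nonempty set `I` of simple reflections is connected if `W_I` is finite and `I` is not a
disjoint union of two nonempty sets `J`, `K` with `W_I = W_J × W_K`. -/
def IsConnectedSubset {B W : Type*} [Group W] {M : CoxeterMatrix B} (cs : CoxeterSystem M W)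
    (I : Set B) : Prop :=
  I.Nonempty ∧ (cs.parabolic I : Set W).Finite ∧
    ¬ ∃ J K : Set B, J.Nonempty ∧ K.Nonempty ∧ Disjoint J K ∧ I = J ∪ K ∧
      IsInternalProd (cs.parabolic I) (cs.parabolic J) (cs.parabolic K)

/-- The family `F(S)` of all connected subsets. -/
abbrev ConnectedSubset {B W : Type*} [Group W] {M : CoxeterMatrix B} (cs : CoxeterSystem M W) :
    Type _ :=
  {I : Set B // cs.IsConnectedSubset I}

/-- `w` is an element of maximal length in `W_I`. -/
def IsLongestIn {B W : Type*} [Group W] {M : CoxeterMatrix B} (cs : CoxeterSystem M W)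
    (I : Set B) (w : W) : Prop :=
  w ∈ cs.parabolic I ∧ ∀ v ∈ cs.parabolic I, cs.length v ≤ cs.length w

theorem exists_isLongestIn {B W : Type*} [Group W] {M : CoxeterMatrix B}
    (cs : CoxeterSystem M W) (I : cs.ConnectedSubset) : ∃ w, cs.IsLongestIn I.1 w := by
  obtain ⟨w, hw, h⟩ := Set.exists_max_image (cs.parabolic I.1 : Set W) cs.length I.2.2.1
    ⟨1, (cs.parabolic I.1).one_mem⟩
  exact ⟨w, hw, h⟩

/-- The longest element `w_I` of the finite group `W_I`, for connected `I`. (The element of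
maximal length in a finite parabolic subgroup is unique, so nothing depends on the choice.) -/
noncomputable def longest {B W : Type*} [Group W] {M : CoxeterMatrix B}
    (cs : CoxeterSystem M W) (I : cs.ConnectedSubset) : W :=
  Classical.choose (cs.exists_isLongestIn I)

/-- The defining relators of the generalized cactus group: `γ_I ^ 2 = 1`, and
`γ_I γ_J = γ_J γ_K` with `K = w_J(I)`, whenever `I ⊆ J` or `W_{I ∪ J} = W_I × W_J`.
Here `w_J(I)` is the set of simple reflections obtained from `I` by conjugation with `w_J`; it is
a connected subset in both cases. -/
def cactusRelators {B W : Type*} [Group W] {M : CoxeterMatrix B} (cs : CoxeterSystem M W) :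
    Set (FreeGroup cs.ConnectedSubset) :=
  {r | ∃ I : cs.ConnectedSubset, r = FreeGroup.of I ^ 2} ∪
  {r | ∃ I J K : cs.ConnectedSubset,
      (I.1 ⊆ J.1 ∨
        IsInternalProd (cs.parabolic (I.1 ∪ J.1)) (cs.parabolic I.1) (cs.parabolic J.1)) ∧
      cs.simple '' K.1 =
        (fun x => cs.longest J * x * (cs.longest J)⁻¹) '' (cs.simple '' I.1) ∧
      r = FreeGroup.of I * FreeGroup.of J * (FreeGroup.of J * FreeGroup.of K)⁻¹}

/-- The generalized cactus group `C_W` of a Coxeter system. -/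
abbrev CactusGroup {B W : Type*} [Group W] {M : CoxeterMatrix B} (cs : CoxeterSystem M W) :
    Type _ :=
  PresentedGroup cs.cactusRelators

/-- The generator `γ_I` of the generalized cactus group. -/
def cactusGen {B W : Type*} [Group W] {M : CoxeterMatrix B} (cs : CoxeterSystem M W)
    (I : cs.ConnectedSubset) : cs.CactusGroup :=
  PresentedGroup.of I

/-- The set of all conjugates `w W_I w⁻¹` with `w ∈ W` and `I` connected. -/
def connectedParabolics {B W : Type*} [Group W] {M : CoxeterMatrix B}
    (cs : CoxeterSystem M W) : Set (Subgroup W) :=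
  {H | ∃ (w : W) (I : cs.ConnectedSubset),
    H = (cs.parabolic I.1).map (MulAut.conj w).toMonoidHom}

open Classical in
/-- The right-angled Coxeter matrix on the set of all `w W_I w⁻¹`: off the diagonal the entry
is `2` if one subgroup contains the other, or if they intersect trivially and centralize each
other; all other entries are `∞`, which a `CoxeterMatrix` encodes as `0`. -/
noncomputable def rightAngledMatrix {B W : Type*} [Group W] {M : CoxeterMatrix B}
    (cs : CoxeterSystem M W) : CoxeterMatrix cs.connectedParabolics where
  M := Matrix.of fun H K =>
    if H = K then 1
    else if H.1 ≤ K.1 ∨ K.1 ≤ H.1 then 2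
    else if H.1 ⊓ K.1 = ⊥ ∧ K.1 ≤ Subgroup.centralizer (H.1 : Set W) then 2
    else 0
  isSymm := by
    refine Matrix.IsSymm.ext fun H K => ?_
    have h1 : K = H ↔ H = K := eq_comm
    have h2 : (K.1 ≤ H.1 ∨ H.1 ≤ K.1) ↔ (H.1 ≤ K.1 ∨ K.1 ≤ H.1) := or_comm
    have h3 : (K.1 ⊓ H.1 = ⊥ ∧ H.1 ≤ Subgroup.centralizer (K.1 : Set W)) ↔
        (H.1 ⊓ K.1 = ⊥ ∧ K.1 ≤ Subgroup.centralizer (H.1 : Set W)) := by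
      rw [inf_comm, Subgroup.le_centralizer_iff]
    simp only [Matrix.of_apply, h1, h2, h3]
  diagonal := fun H => by simp
  off_diagonal := fun H K h => by
    simp only [Matrix.of_apply, if_neg h]
    split_ifs <;> decide

end CoxeterSystem

/-! `W` permutes the conjugates of connected parabolic subgroups and so acts on the right-angled
group `𝕎`. Sending `γ_I` to `(τ_{W_I}, w_I)` defines a homomorphism from `C_W` to `𝕎 ⋊ W`: when `γ_I
γ_J = γ_J γ_K` is a relation, `w_I` normalizes `W_J`, `w_J` carries `W_K` to `W_I`, and `τ_{W_I}`
commutes with `τ_{W_J}`. The second component is `g_W`. On its kernel the first component is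
multiplicative, and this is the required map.

Injectivity comes from an action of `𝕎` on the set `C_W`: `τ_H` sends `y` to `y γ_I` if `H = g_W(y)
W_I g_W(y)⁻¹` and fixes `y` if there is no such `I`. The cactus relations make this respect the
relations of `𝕎` (`cactusAct_mul_self`, `cactusAct_comm`). The inverse of the first component of `y`
then sends `1` to `y`, rebuilding `y` letter by letter (`cactusActHom_left_inv_one`), so that
component determines `y`.

Two facts about Coxeter groups are needed. The exchange condition makes longest elements unique
involutions that permute the simple reflections of `W_I`. The geometric representation shows that
simple reflections are distinct, so `I` is determined by `W_I`. -/

theorem Function.End.mul_apply {α : Type*} (f g : Function.End α) (a : α) :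
    (f * g) a = f (g a) := rfl

namespace CoxeterSystem

/-! ### The exchange condition -/

section Exchange

variable {B W : Type*} [Group W] {M : CoxeterMatrix B} (cs : CoxeterSystem M W)

open Classical in
/-- The action of a simple reflection on pairs of a group element and a sign: it conjugates the
element, and flips the sign precisely when the element is that simple reflection. -/
noncomputable def signedConj (i : B) : Function.End (W × ZMod 2) :=
  fun p => (cs.simple i * p.1 * cs.simple i, p.2 + if p.1 = cs.simple i then 1 else 0)

-- Each factor contributes one possible flip, hence `2 * k` terms. Since `s_j` inverts `r = s_i
-- s_j`, every flip condition can be rewritten as `r ^ n * t = s_j`.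
open Classical in
theorem signedConj_mul_pow_apply (i j : B) (k : ℕ) (t : W) (ε : ZMod 2) :
    ((cs.signedConj i * cs.signedConj j) ^ k) (t, ε) =
      ((cs.simple i * cs.simple j) ^ k * t * ((cs.simple i * cs.simple j) ^ k)⁻¹,
        ε + ∑ n ∈ Finset.range (2 * k),
          if (cs.simple i * cs.simple j) ^ n * t = cs.simple j then 1 else 0) := by
  induction k with
  | zero => simp [Function.End.one_def]
  | succ k ih =>
    set r := cs.simple i * cs.simple j with hr
    have hflip : ∀ n : ℕ, r ^ n * cs.simple j * r ^ n = cs.simple j := by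
      intro n
      induction n with
      | zero => simp
      | succ n ihn =>
        rw [pow_succ]
        nth_rw 2 [← pow_succ]
        rw [pow_succ', hr, ← hr]
        calc r ^ n * r * cs.simple j * (r * r ^ n)
            = r ^ n * (r * cs.simple j * r) * r ^ n := by simp only [mul_assoc]
          _ = r ^ n * cs.simple j * r ^ n := by simp [hr, mul_assoc]
          _ = _ := ihn
    have h1 : r ^ k * t * (r ^ k)⁻¹ = cs.simple j ↔ r ^ (2 * k) * t = cs.simple j := by
      rw [mul_inv_eq_iff_eq_mul, two_mul, pow_add, mul_assoc, ← mul_right_inj (r ^ k)]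
      nth_rw 2 [← mul_assoc]
      rw [hflip]
    have h2 : cs.simple j * (r ^ k * t * (r ^ k)⁻¹) * cs.simple j = cs.simple i ↔
        r ^ (2 * k + 1) * t = cs.simple j := by
      have e : r ^ (2 * k + 1) * t = r ^ k * (r * (r ^ k * t)) := by
        rw [two_mul, pow_succ, pow_add]
        simp only [mul_assoc]
        rw [← mul_assoc r, ← mul_assoc (r ^ k) r, ← pow_succ, pow_succ', mul_assoc]
      rw [e]
      nth_rw 3 [← hflip k]
      rw [mul_assoc (r ^ k) (cs.simple j), mul_right_inj]
      rw [← mul_inv_eq_iff_eq_mul]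
      rw [hr, ← hr]
      constructor
      · intro h
        have : cs.simple i * (cs.simple j * (r ^ k * t * (r ^ k)⁻¹) * cs.simple j) * cs.simple j
            = cs.simple i * cs.simple i * cs.simple j := by rw [h]
        simpa [hr, mul_assoc] using this
      · intro h
        have : cs.simple i * (r * (r ^ k * t) * (r ^ k)⁻¹) * cs.simple j
            = cs.simple i * cs.simple j * cs.simple j := by rw [h]
        simpa [hr, mul_assoc] using this
    rw [pow_succ', Function.End.mul_apply, ih]
    simp only [Function.End.mul_apply, signedConj, h1, h2]
    refine Prod.ext ?_ ?_
    · simp [pow_succ', hr, mul_assoc]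
    · rw [mul_add, mul_one, Finset.sum_range_succ, Finset.sum_range_succ]
      simp only [add_assoc]

/-- For `k = M i j` the power `r ^ n` has period `k`, so the `2 * k` sign terms form two equal
halves and cancel modulo 2. -/
theorem isLiftable_signedConj : M.IsLiftable cs.signedConj := by
  classical
  intro i j
  funext ⟨t, ε⟩
  rw [signedConj_mul_pow_apply, two_mul, Finset.sum_range_add]
  simp [pow_add, Function.End.one_def, CharTwo.add_self_eq_zero]

/-- The action of the Coxeter group on pairs of a group element and a sign. -/
noncomputable def signedConjHom : W →* Function.End (W × ZMod 2) :=
  cs.lift ⟨cs.signedConj, cs.isLiftable_signedConj⟩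

-- Consequently the parity of the number of occurrences of `t` in the right inversion sequence
-- depends only on the group element, not on the word.
open Classical in
theorem signedConjHom_wordProd (ω : List B) (t : W) (ε : ZMod 2) :
    cs.signedConjHom (cs.wordProd ω) (t, ε) =
      (cs.wordProd ω * t * (cs.wordProd ω)⁻¹, ε + (cs.rightInvSeq ω).count t) := by
  induction ω with
  | nil => simp [Function.End.one_def]
  | cons i ω ih =>
    have h : (cs.wordProd ω * t * (cs.wordProd ω)⁻¹ = cs.simple i) ↔
        ((cs.wordProd ω)⁻¹ * cs.simple i * cs.wordProd ω = t) := by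
      rw [mul_inv_eq_iff_eq_mul, eq_comm, mul_assoc, inv_mul_eq_iff_eq_mul]
    rw [wordProd_cons, map_mul, Function.End.mul_apply, ih, signedConjHom,
      cs.lift_apply_simple]
    simp only [signedConj, rightInvSeq, List.count_cons, beq_iff_eq, h]
    refine Prod.ext ?_ ?_
    · simp [mul_assoc]
    · push_cast
      simp [add_assoc]

theorem simple_mem_rightInvSeq {ω : List B} {i : B} (h : cs.IsRightDescent (cs.wordProd ω) i) :
    cs.simple i ∈ cs.rightInvSeq ω := by
  classical
  by_contra hmem
  -- If `s_i` were absent for `ω`, it would occur an odd number of times for a reduced word of `w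
  -- s_i`. Then `w = (w s_i) s_i` would be shorter than `w s_i`, against the descent.
  obtain ⟨ω', hω', hprod⟩ := cs.exists_isReduced (cs.wordProd ω * cs.simple i)
  have h1 := cs.signedConjHom_wordProd ω' (cs.simple i) 0
  rw [← hprod, map_mul, Function.End.mul_apply] at h1
  nth_rw 2 [signedConjHom] at h1
  rw [cs.lift_apply_simple] at h1
  simp only [signedConj, if_true, simple_mul_simple_self, one_mul] at h1
  rw [signedConjHom_wordProd, List.count_eq_zero_of_not_mem hmem] at h1
  have h2 : cs.simple i ∈ cs.rightInvSeq ω' := by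
    by_contra hmem'
    rw [List.count_eq_zero_of_not_mem hmem'] at h1
    simpa using congrArg Prod.snd h1
  have h3 := (cs.isRightInversion_of_mem_rightInvSeq hω' h2).2
  rw [← hprod, simple_mul_simple_cancel_right] at h3
  exact lt_asymm h h3

/-- The exchange condition. -/
theorem exists_wordProd_eraseIdx {ω : List B} {i : B}
    (h : cs.IsRightDescent (cs.wordProd ω) i) :
    ∃ j < ω.length, cs.wordProd ω * cs.simple i = cs.wordProd (ω.eraseIdx j) := by
  obtain ⟨j, hj, hji⟩ := List.mem_iff_getElem.mp (cs.simple_mem_rightInvSeq h)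
  refine ⟨j, by simpa using hj, ?_⟩
  rw [← wordProd_mul_getD_rightInvSeq, List.getD_eq_getElem _ _ hj, hji]

end Exchange

/-! ### Parabolic subgroups -/

section Parabolic

variable {B W : Type*} [Group W] {M : CoxeterMatrix B} (cs : CoxeterSystem M W)

variable {cs} in
theorem simple_mem_parabolic {I : Set B} {i : B} (hi : i ∈ I) : cs.simple i ∈ cs.parabolic I :=
  Subgroup.subset_closure ⟨i, hi, rfl⟩

theorem parabolic_mono {I J : Set B} (h : I ⊆ J) : cs.parabolic I ≤ cs.parabolic J :=
  Subgroup.closure_mono (Set.image_mono h)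

theorem parabolic_union (I J : Set B) :
    cs.parabolic (I ∪ J) = cs.parabolic I ⊔ cs.parabolic J := by
  rw [parabolic, Set.image_union, Subgroup.closure_union]
  rfl

/-- Every element of a standard parabolic subgroup `W_I` has a reduced word with letters in `I`. -/
theorem exists_isReduced_of_mem_parabolic {I : Set B} {w : W} (hw : w ∈ cs.parabolic I) :
    ∃ ω : List B, cs.IsReduced ω ∧ (∀ i ∈ ω, i ∈ I) ∧ cs.wordProd ω = w := by
  have step : ∀ (w : W) (i : B), i ∈ I →
      (∃ ω : List B, cs.IsReduced ω ∧ (∀ i ∈ ω, i ∈ I) ∧ cs.wordProd ω = w) →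
      ∃ ω : List B, cs.IsReduced ω ∧ (∀ i ∈ ω, i ∈ I) ∧ cs.wordProd ω = w * cs.simple i := by
    rintro _ i hi ⟨ω, hω, hI, rfl⟩
    rcases cs.length_mul_simple (cs.wordProd ω) i with hl | hl
    · refine ⟨ω ++ [i], ?_, ?_, ?_⟩
      · rw [IsReduced, wordProd_append, wordProd_singleton, hl, hω.eq]
        simp
      · intro j hj
        rcases List.mem_append.mp hj with hj | hj
        · exact hI j hj
        · rwa [List.mem_singleton.mp hj]
      · simp [wordProd_append]
    · obtain ⟨j, hj, he⟩ := cs.exists_wordProd_eraseIdx (ω := ω) (i := i)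
        (by rw [IsRightDescent]; omega)
      refine ⟨ω.eraseIdx j, ?_, fun k hk => hI k (List.mem_of_mem_eraseIdx hk), he.symm⟩
      have := List.length_eraseIdx_add_one hj
      rw [IsReduced, ← he]
      rw [hω.eq] at hl
      omega
  induction hw using Subgroup.closure_induction_right with
  | one => exact ⟨[], by simp [IsReduced], by simp, by simp⟩
  | mul_right x hx y hy ih =>
    obtain ⟨i, hi, rfl⟩ := hy
    exact step x i hi ih
  | mul_inv_cancel x hx y hy ih =>
    obtain ⟨i, hi, rfl⟩ := hy
    rw [inv_simple]
    exact step x i hi ih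

/-! ### Longest elements -/

variable {cs} {I : Set B} {w v : W}

/-- Multiplying a longest element by an element of the subgroup subtracts the lengths. -/
theorem IsLongestIn.length_mul_inv_add (hw : cs.IsLongestIn I w) (hv : v ∈ cs.parabolic I) :
    cs.length (w * v⁻¹) + cs.length v = cs.length w := by
  obtain ⟨ω, hω, hI, rfl⟩ := cs.exists_isReduced_of_mem_parabolic hv
  clear hv
  induction ω using List.reverseRecOn with
  | nil => simp
  | append_singleton ω i ih =>
    have hω' : cs.IsReduced ω := by simpa using hω.take ω.length
    replace ih := ih hω' fun j hj => hI j (by simp [hj])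
    obtain ⟨ξ, hξ, hξw⟩ := cs.exists_isReduced (w * (cs.wordProd ω)⁻¹)
    have hwξ : w = cs.wordProd (ξ ++ ω) := by
      rw [wordProd_append, ← hξw, inv_mul_cancel_right]
    have hi : i ∈ I := hI i (by simp)
    have hdesc : cs.IsRightDescent w i := lt_of_le_of_ne
      (hw.2 _ (mul_mem hw.1 (simple_mem_parabolic hi))) (cs.length_mul_simple_ne w i)
    rw [hwξ] at hdesc
    obtain ⟨j, hj, he⟩ := cs.exists_wordProd_eraseIdx hdesc
    rw [← hwξ] at he
    have hlen : cs.length (cs.wordProd (ω ++ [i])) = ω.length + 1 := by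
      rw [hω.eq]; simp
    rw [hω'.eq, hξw, hξ.eq] at ih
    rw [hlen]
    -- Here `w = ξ ω`, and exchange deletes one letter to give `w s_i`. A letter deleted from `ξ`
    -- gives the bound; one deleted from `ω` would contradict reducedness of `ω s_i`.
    by_cases hjξ : j < ξ.length
    · rw [List.eraseIdx_append_of_lt_length hjξ, wordProd_append] at he
      have hle : cs.length (w * (cs.wordProd (ω ++ [i]))⁻¹) ≤ (ξ.eraseIdx j).length := by
        have : w * (cs.wordProd (ω ++ [i]))⁻¹ = cs.wordProd (ξ.eraseIdx j) := by
          rw [wordProd_append, wordProd_singleton, mul_inv_rev, inv_simple, ← mul_assoc, he,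
            mul_inv_cancel_right]
        rw [this]
        exact cs.length_wordProd_le _
      have h1 := List.length_eraseIdx_add_one hjξ
      have h2 := cs.length_mul_le (w * (cs.wordProd (ω ++ [i]))⁻¹) (cs.wordProd (ω ++ [i]))
      rw [inv_mul_cancel_right, hlen] at h2
      omega
    · exfalso
      push Not at hjξ
      rw [List.eraseIdx_append_of_length_le hjξ, wordProd_append, hwξ, wordProd_append,
        mul_assoc, mul_right_inj] at he
      rw [wordProd_append, wordProd_singleton, he] at hlen
      have h1 := cs.length_wordProd_le (ω.eraseIdx (j - ξ.length))
      have h2 := List.length_eraseIdx_le ω (j - ξ.length)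
      omega

theorem IsLongestIn.mul_self (hw : cs.IsLongestIn I w) : w * w = 1 := by
  have h := hw.length_mul_inv_add (inv_mem hw.1)
  rw [inv_inv, length_inv, Nat.add_eq_right] at h
  exact cs.length_eq_zero_iff.mp h

theorem IsLongestIn.inv_eq (hw : cs.IsLongestIn I w) : w⁻¹ = w :=
  inv_eq_of_mul_eq_one_right hw.mul_self

theorem IsLongestIn.unique (hw : cs.IsLongestIn I w) (hv : cs.IsLongestIn I v) : w = v := by
  have h := hw.length_mul_inv_add hv.1
  have h' := hw.2 v hv.1
  have h'' := hv.2 w hw.1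
  exact mul_inv_eq_one.mp (cs.length_eq_zero_iff.mp (by omega))

/-- Conjugation by the longest element of `W_I` permutes the simple reflections in `I`. -/
theorem IsLongestIn.exists_conj_simple (hw : cs.IsLongestIn I w) {i : B} (hi : i ∈ I) :
    ∃ j ∈ I, w * cs.simple i * w⁻¹ = cs.simple j := by
  have hs := simple_mem_parabolic (cs := cs) hi
  -- The element `w s_i w⁻¹ = w (w s_i)⁻¹` has length `ℓ(w) - ℓ(w s_i) = 1`.
  have h1 := hw.length_mul_inv_add hs
  have h2 := hw.length_mul_inv_add (mul_mem hw.1 hs)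
  have h3 : cs.length (w * (w * cs.simple i)⁻¹) = 1 := by
    rw [inv_simple, length_simple] at h1
    omega
  have h4 : w * (w * cs.simple i)⁻¹ = w * cs.simple i * w⁻¹ := by
    rw [mul_inv_rev, inv_simple, mul_assoc]
  rw [h4] at h3
  obtain ⟨ω, hω, hI, he⟩ :=
    cs.exists_isReduced_of_mem_parabolic (mul_mem (mul_mem hw.1 hs) (inv_mem hw.1))
  rw [← he, hω.eq] at h3
  obtain ⟨j, rfl⟩ := List.length_eq_one_iff.mp h3
  exact ⟨j, hI j (by simp), by rw [← he, wordProd_singleton]⟩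

end Parabolic

end CoxeterSystem

/-! ### The simple reflections are distinct -/

section Geometric

open Polynomial.Chebyshev Module

/-- The product of two reflections with the angle `π / m` has order dividing `m`. -/
theorem Module.reflection_mul_reflection_pow_eq_one {V : Type*} [AddCommGroup V] [Module ℝ V]
    {x y : V} {f g : Dual ℝ V} (hf : f x = 2) (hg : g y = 2) {m : ℕ} (hm : 2 ≤ m)
    (hfy : f y = -2 * Real.cos (Real.pi / m)) (hgx : g x = -2 * Real.cos (Real.pi / m)) :
    (reflection hf * reflection hg) ^ m = 1 := by
  have hm0 : (0 : ℝ) < m := by positivity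
  have ht : f y * g x - 2 = 2 * Real.cos (2 * (Real.pi / m)) := by
    rw [hfy, hgx, Real.cos_two_mul]; ring
  ext z
  rw [reflection_mul_reflection_pow_apply hf hg m z _ rfl, ht]
  -- For `m = 2` the angle `θ` is `π` and `sin θ = 0`, so the quotient formula for `S` is
  -- unavailable; the other cases use `m θ = 2 π`.
  rcases eq_or_ne m 2 with rfl | hm2
  · have h0 : Real.cos (2 * (Real.pi / (2 : ℕ))) = -1 := by
      rw [Nat.cast_ofNat, mul_div_cancel₀ _ two_ne_zero, Real.cos_pi]
    have h1 : Real.cos (Real.pi / (2 : ℕ)) = 0 := by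
      rw [Nat.cast_ofNat, Real.cos_pi_div_two]
    rw [h1, mul_zero] at hfy hgx
    rw [h0, hfy, hgx]
    norm_num
    module
  set θ := 2 * (Real.pi / m) with hθ
  have hmθ : m * θ = 2 * Real.pi := by rw [hθ]; field_simp
  have hsin : Real.sin θ ≠ 0 := by
    have h3 : 3 ≤ m := by omega
    have h3' : (3 : ℝ) ≤ m := by exact_mod_cast h3
    refine (Real.sin_pos_of_pos_of_lt_pi (by positivity) ?_).ne'
    rw [hθ, ← mul_div_assoc, div_lt_iff₀ hm0]
    nlinarith [Real.pi_pos]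
  have hS : ∀ n : ℤ, (S ℝ n).eval (2 * Real.cos θ) = Real.sin ((n + 1) * θ) / Real.sin θ :=
    fun n => by rw [eq_div_iff hsin, S_two_mul_real_cos]
  rcases Nat.even_or_odd' m with ⟨p, hp | hp⟩
  · have hpθ : p * θ = Real.pi := by
      rw [hp] at hmθ; push_cast at hmθ; linarith
    have e1 : ((m : ℤ) - 2) / 2 = (p : ℤ) - 1 := by omega
    have e2 : ((m : ℤ) - 1) / 2 = (p : ℤ) - 1 := by omega
    have h0 : (S ℝ ((p : ℤ) - 1)).eval (2 * Real.cos θ) = 0 := by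
      rw [hS]; push_cast; rw [sub_add_cancel, hpθ, Real.sin_pi, zero_div]
    rw [e1, e2, h0]
    simp
  · have hpθ : (p + 1) * θ = 2 * Real.pi - p * θ := by
      rw [hp] at hmθ; push_cast at hmθ; linarith
    have e1 : ((m : ℤ) - 1) / 2 = p := by omega
    have e2 : ((m : ℤ) - 3) / 2 = (p : ℤ) - 1 := by omega
    have e3 : (m : ℤ) / 2 = p := by omega
    have e4 : ((m : ℤ) - 2) / 2 = (p : ℤ) - 1 := by omega
    have h0 : (S ℝ (p : ℤ)).eval (2 * Real.cos θ) +
        (S ℝ ((p : ℤ) - 1)).eval (2 * Real.cos θ) = 0 := by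
      rw [hS, hS]; push_cast
      rw [sub_add_cancel, hpθ, Real.sin_two_pi_sub]
      ring
    rw [e1, e2, e3, e4, h0]
    simp

end Geometric

namespace CoxeterSystem

section Faithful

open Module

variable {B W : Type*} [Group W] {M : CoxeterMatrix B} (cs : CoxeterSystem M W)

/-- The linear form attached to a simple reflection in the geometric representation. -/
noncomputable def _root_.CoxeterMatrix.simpleCoroot (M : CoxeterMatrix B) (i : B) :
    Dual ℝ (B →₀ ℝ) :=
  -- An infinite entry is encoded as `0`; since `π / 0 = 0` in Lean, it yields the usual value `-2`.
  Finsupp.lift ℝ ℝ B fun j => -2 * Real.cos (Real.pi / M i j)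

theorem _root_.CoxeterMatrix.simpleCoroot_single (M : CoxeterMatrix B) (i j : B) :
    M.simpleCoroot i (Finsupp.single j 1) = -2 * Real.cos (Real.pi / M i j) := by
  simp [CoxeterMatrix.simpleCoroot]

theorem _root_.CoxeterMatrix.simpleCoroot_single_self (M : CoxeterMatrix B) (i : B) :
    M.simpleCoroot i (Finsupp.single i 1) = 2 := by
  simp [CoxeterMatrix.simpleCoroot_single]

theorem isLiftable_reflection :
    M.IsLiftable fun i => reflection (M.simpleCoroot_single_self i) := by
  intro i j
  rcases Nat.lt_or_ge (M i j) 2 with h | h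
  · rcases eq_or_ne i j with rfl | hij
    · ext z
      simp [LinearEquiv.mul_apply, involutive_reflection (M.simpleCoroot_single_self i) _]
    · have h0 : M i j = 0 := by
        have := M.off_diagonal i j hij
        omega
      simp [h0]
  · refine reflection_mul_reflection_pow_eq_one _ _ h ?_ ?_
    · rw [M.simpleCoroot_single]
    · rw [M.simpleCoroot_single, M.symmetric]

/-- Distinct indices give distinct simple reflections. -/
theorem simple_injective : Function.Injective cs.simple := by
  intro i j hij
  by_contra hne
  have h := congrArg (cs.lift ⟨_, isLiftable_reflection (M := M)⟩) hij
  rw [cs.lift_apply_simple, cs.lift_apply_simple] at h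
  -- Reflection `i` negates the basis vector `e_i`, whereas reflection `j` changes only the
  -- `j`-coordinate and leaves the `i`-coordinate equal to `1`.
  have h' := congrArg (fun v => v i) (LinearEquiv.congr_fun h (Finsupp.single i 1))
  rw [reflection_apply_self] at h'
  simp [reflection_apply, Ne.symm hne] at h'
  linarith

theorem simple_mem_parabolic_iff {I : Set B} {i : B} :
    cs.simple i ∈ cs.parabolic I ↔ i ∈ I := by
  refine ⟨fun h => ?_, simple_mem_parabolic⟩
  obtain ⟨ω, hω, hI, he⟩ := cs.exists_isReduced_of_mem_parabolic h
  have h1 := hω.eq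
  rw [he, length_simple] at h1
  obtain ⟨j, rfl⟩ := List.length_eq_one_iff.mp h1.symm
  rw [wordProd_singleton] at he
  rw [← cs.simple_injective he]
  exact hI j (by simp)

theorem parabolic_le_iff {I J : Set B} : cs.parabolic I ≤ cs.parabolic J ↔ I ⊆ J :=
  ⟨fun h _ hi => cs.simple_mem_parabolic_iff.mp (h (simple_mem_parabolic hi)),
    cs.parabolic_mono⟩

theorem parabolic_injective : Function.Injective cs.parabolic := fun _ _ h =>
  (cs.parabolic_le_iff.mp h.le).antisymm (cs.parabolic_le_iff.mp h.ge)

end Faithful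

end CoxeterSystem

/-! ### Conjugate subgroups -/

namespace Subgroup

variable {G : Type*} [Group G]

/-- The conjugate subgroup `g H g⁻¹`. -/
abbrev conjBy (g : G) (H : Subgroup G) : Subgroup G :=
  H.map (MulAut.conj g).toMonoidHom

theorem mem_conjBy {g x : G} {H : Subgroup G} : x ∈ conjBy g H ↔ g⁻¹ * x * g ∈ H := by
  constructor
  · rintro ⟨y, hy, rfl⟩
    simpa [mul_assoc] using hy
  · intro h
    exact ⟨_, h, by simp [mul_assoc]⟩

theorem conjBy_mul (g h : G) (H : Subgroup G) : conjBy (g * h) H = conjBy g (conjBy h H) := by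
  ext x
  simp [mul_assoc]

@[simp]
theorem conjBy_one (H : Subgroup G) : conjBy 1 H = H := by
  ext x
  simp

theorem conjBy_le_conjBy {g : G} {H K : Subgroup G} : conjBy g H ≤ conjBy g K ↔ H ≤ K :=
  Subgroup.map_le_map_iff_of_injective (MulAut.conj g).injective

theorem conjBy_injective (g : G) : Function.Injective (conjBy g) :=
  Subgroup.map_injective (MulAut.conj g).injective

theorem conjBy_eq_self_of_mem {g : G} {H : Subgroup G} (hg : g ∈ H) : conjBy g H = H := by
  ext x
  rw [mem_conjBy, H.mul_mem_cancel_right hg, H.mul_mem_cancel_left (inv_mem hg)]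

theorem conjBy_eq_self_of_forall_commute {g : G} {H : Subgroup G}
    (hg : ∀ h ∈ H, g * h = h * g) : conjBy g H = H := by
  have key : ∀ h ∈ H, g * h * g⁻¹ = h := fun h hh => by rw [hg h hh, mul_inv_cancel_right]
  ext x
  constructor
  · rintro ⟨y, hy, rfl⟩
    simpa [key y hy] using hy
  · intro hx
    exact ⟨x, hx, by simpa using key x hx⟩

/-- Two subgroups are compatible if one contains the other, or if they intersect trivially and
centralize each other. -/
def IsCompatible (H K : Subgroup G) : Prop :=
  H ≤ K ∨ K ≤ H ∨ (H ⊓ K = ⊥ ∧ ∀ h ∈ H, ∀ k ∈ K, h * k = k * h)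

theorem IsCompatible.symm {H K : Subgroup G} (h : IsCompatible H K) : IsCompatible K H := by
  rcases h with h | h | ⟨h, h'⟩
  · exact Or.inr (Or.inl h)
  · exact Or.inl h
  · exact Or.inr (Or.inr ⟨by rwa [inf_comm], fun k hk l hl => (h' l hl k hk).symm⟩)

theorem isCompatible_conjBy_iff {g : G} {H K : Subgroup G} :
    IsCompatible (conjBy g H) (conjBy g K) ↔ IsCompatible H K := by
  unfold IsCompatible
  rw [conjBy_le_conjBy, conjBy_le_conjBy, ← Subgroup.map_inf _ _ _ (MulAut.conj g).injective,
    Subgroup.map_eq_bot_iff_of_injective _ (MulAut.conj g).injective]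
  simp [Subgroup.mem_map]

end Subgroup

namespace CoxeterSystem

open Subgroup

variable {B W : Type*} [Group W] {M : CoxeterMatrix B} (cs : CoxeterSystem M W)

/-! ### Conjugate sets of simple reflections -/

/-- Conjugation by `w` maps the simple reflections in `I` onto the simple reflections in `K`. -/
def IsConjSimple (w : W) (I K : Set B) : Prop :=
  cs.simple '' K = (fun x => w * x * w⁻¹) '' (cs.simple '' I)

variable {cs} {w u : W} {I J K : Set B}

theorem IsConjSimple.symm (h : cs.IsConjSimple w I K) : cs.IsConjSimple w⁻¹ K I := by
  rw [IsConjSimple, h, Set.image_image]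
  simp [mul_assoc]

theorem IsConjSimple.parabolic_eq (h : cs.IsConjSimple w I K) :
    cs.parabolic K = conjBy w (cs.parabolic I) := by
  rw [parabolic, h, parabolic, conjBy, MonoidHom.map_closure]
  rfl

theorem IsConjSimple.exists_simple (h : cs.IsConjSimple w I K) {i : B} (hi : i ∈ I) :
    ∃ k ∈ K, cs.simple k = w * cs.simple i * w⁻¹ := by
  have : w * cs.simple i * w⁻¹ ∈ cs.simple '' K := by
    rw [h]
    exact ⟨_, ⟨i, hi, rfl⟩, rfl⟩
  exact this

theorem IsConjSimple.exists_wordProd (h : cs.IsConjSimple w I K) {ω : List B}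
    (hω : ∀ i ∈ ω, i ∈ I) :
    ∃ ω' : List B, ω'.length = ω.length ∧ cs.wordProd ω' = w * cs.wordProd ω * w⁻¹ := by
  induction ω with
  | nil => exact ⟨[], by simp⟩
  | cons i ω ih =>
    obtain ⟨ω', hl, he⟩ := ih fun j hj => hω j (by simp [hj])
    obtain ⟨k, -, hk⟩ := h.exists_simple (hω i (by simp))
    exact ⟨k :: ω', by simp [hl], by simp [wordProd_cons, he, hk, mul_assoc]⟩

theorem IsConjSimple.length_le (h : cs.IsConjSimple w I K) (hu : u ∈ cs.parabolic I) :
    cs.length (w * u * w⁻¹) ≤ cs.length u := by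
  obtain ⟨ω, hω, hI, rfl⟩ := cs.exists_isReduced_of_mem_parabolic hu
  obtain ⟨ω', hl, he⟩ := h.exists_wordProd hI
  rw [← he, hω.eq, ← hl]
  exact cs.length_wordProd_le ω'

/-- Conjugation by `w` and by `w⁻¹` both turn words into words of the same length, so neither
increases length. -/
theorem IsConjSimple.isLongestIn (h : cs.IsConjSimple w I K) (hu : cs.IsLongestIn I u) :
    cs.IsLongestIn K (w * u * w⁻¹) := by
  have hmem : w * u * w⁻¹ ∈ cs.parabolic K := by
    rw [h.parabolic_eq, mem_conjBy]
    simpa [mul_assoc] using hu.1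
  refine ⟨hmem, fun v hv => ?_⟩
  have h1 : w⁻¹ * v * w ∈ cs.parabolic I := by
    rwa [h.parabolic_eq, mem_conjBy] at hv
  have h2 := h.length_le h1
  have h3 := hu.2 _ h1
  have h4 := h.symm.length_le hmem
  simp only [mul_assoc, mul_inv_cancel_left, mul_inv_cancel, mul_one, inv_inv, inv_mul_cancel,
    inv_mul_cancel_left] at *
  omega

theorem IsConjSimple.exists_subset (h : cs.IsConjSimple w I K) (hJ : J ⊆ K) :
    ∃ I' ⊆ I, cs.IsConjSimple w I' J := by
  refine ⟨{i ∈ I | w * cs.simple i * w⁻¹ ∈ cs.simple '' J}, fun i hi => hi.1, ?_⟩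
  apply Set.Subset.antisymm
  · rintro _ ⟨j, hj, rfl⟩
    have : cs.simple j ∈ cs.simple '' K := ⟨j, hJ hj, rfl⟩
    rw [h] at this
    obtain ⟨_, ⟨i, hi, rfl⟩, he⟩ := this
    exact ⟨_, ⟨i, ⟨hi, j, hj, he.symm⟩, rfl⟩, he⟩
  · rintro _ ⟨_, ⟨i, hi, rfl⟩, rfl⟩
    exact hi.2

theorem isInternalProd_of_conjBy {G : Type*} [Group G] {g : G} {L H N : Subgroup G}
    (h : IsInternalProd (conjBy g L) (conjBy g H) (conjBy g N)) : IsInternalProd L H N := by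
  obtain ⟨h1, h2, h3⟩ := h
  refine ⟨?_, fun x hx y hy => ?_, ?_⟩
  · rwa [← Subgroup.map_inf _ _ _ (MulAut.conj g).injective,
      Subgroup.map_eq_bot_iff_of_injective _ (MulAut.conj g).injective] at h1
  · refine (MulAut.conj g).injective ?_
    rw [map_mul, map_mul]
    exact h2 _ (Subgroup.mem_map_of_mem _ hx) _ (Subgroup.mem_map_of_mem _ hy)
  · rw [← Subgroup.map_sup] at h3
    exact conjBy_injective g h3

theorem IsConjSimple.isConnectedSubset (h : cs.IsConjSimple w I K)
    (hI : cs.IsConnectedSubset I) : cs.IsConnectedSubset K := by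
  obtain ⟨hne, hfin, hirr⟩ := hI
  refine ⟨?_, ?_, ?_⟩
  · obtain ⟨i, hi⟩ := hne
    obtain ⟨k, hk, -⟩ := h.exists_simple hi
    exact ⟨k, hk⟩
  · rw [h.parabolic_eq, Subgroup.coe_map]
    exact hfin.image _
  · rintro ⟨J₁, J₂, ⟨j₁, hj₁⟩, ⟨j₂, hj₂⟩, hdisj, rfl, hprod⟩
    obtain ⟨I₁, hI₁, h₁⟩ := h.exists_subset Set.subset_union_left
    obtain ⟨I₂, hI₂, h₂⟩ := h.exists_subset Set.subset_union_right
    refine hirr ⟨I₁, I₂, ?_, ?_, ?_, ?_, ?_⟩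
    · obtain ⟨i, hi, -⟩ := h₁.symm.exists_simple hj₁
      exact ⟨i, hi⟩
    · obtain ⟨i, hi, -⟩ := h₂.symm.exists_simple hj₂
      exact ⟨i, hi⟩
    · rw [Set.disjoint_left]
      intro i hi₁ hi₂
      obtain ⟨k₁, hk₁, he₁⟩ := h₁.exists_simple hi₁
      obtain ⟨k₂, hk₂, he₂⟩ := h₂.exists_simple hi₂
      rw [cs.simple_injective (he₁.trans he₂.symm)] at hk₁
      exact Set.disjoint_left.mp hdisj hk₁ hk₂
    · refine Set.Subset.antisymm (fun i hi => ?_) (Set.union_subset hI₁ hI₂)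
      obtain ⟨k, hk, he⟩ := h.exists_simple hi
      rcases hk with hk | hk
      · obtain ⟨i', hi', he'⟩ := h₁.symm.exists_simple hk
        rw [he] at he'
        rw [← cs.simple_injective (a₁ := i') (a₂ := i) (by rw [he']; simp [mul_assoc])]
        exact Or.inl hi'
      · obtain ⟨i', hi', he'⟩ := h₂.symm.exists_simple hk
        rw [he] at he'
        rw [← cs.simple_injective (a₁ := i') (a₂ := i) (by rw [he']; simp [mul_assoc])]
        exact Or.inr hi'
    · rw [h.parabolic_eq, h₁.parabolic_eq, h₂.parabolic_eq] at hprod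
      exact isInternalProd_of_conjBy hprod

/-! ### Longest elements of connected subsets -/

variable (cs)

theorem isLongestIn_longest (I : cs.ConnectedSubset) : cs.IsLongestIn I.1 (cs.longest I) :=
  Classical.choose_spec (cs.exists_isLongestIn I)

theorem longest_mem (I : cs.ConnectedSubset) : cs.longest I ∈ cs.parabolic I.1 :=
  (cs.isLongestIn_longest I).1

theorem longest_mul_self (I : cs.ConnectedSubset) : cs.longest I * cs.longest I = 1 :=
  (cs.isLongestIn_longest I).mul_self

theorem inv_longest (I : cs.ConnectedSubset) : (cs.longest I)⁻¹ = cs.longest I :=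
  (cs.isLongestIn_longest I).inv_eq

/-- The condition under which the generators `γ_I` and `γ_J` of the cactus group are related. -/
def CactusRelated (I J : Set B) : Prop :=
  I ⊆ J ∨ IsInternalProd (cs.parabolic (I ∪ J)) (cs.parabolic I) (cs.parabolic J)

variable {cs}

/-- This matches the commutation condition of the right-angled group with the cactus relations; the
generation clause of the internal product is automatic for `W_{I ∪ J}`. -/
theorem isCompatible_iff_cactusRelated :
    IsCompatible (cs.parabolic I) (cs.parabolic J) ↔
      cs.CactusRelated I J ∨ cs.CactusRelated J I := by
  have hprod : ∀ I J : Set B,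
      IsInternalProd (cs.parabolic (I ∪ J)) (cs.parabolic I) (cs.parabolic J) ↔
        cs.parabolic I ⊓ cs.parabolic J = ⊥ ∧
          ∀ h ∈ cs.parabolic I, ∀ k ∈ cs.parabolic J, h * k = k * h := fun I J => by
    simp [IsInternalProd, parabolic_union]
  have hsymm : (cs.parabolic J ⊓ cs.parabolic I = ⊥ ∧
          ∀ h ∈ cs.parabolic J, ∀ k ∈ cs.parabolic I, h * k = k * h) ↔
      (cs.parabolic I ⊓ cs.parabolic J = ⊥ ∧
          ∀ h ∈ cs.parabolic I, ∀ k ∈ cs.parabolic J, h * k = k * h) := by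
    rw [inf_comm]
    exact and_congr_right fun _ =>
      ⟨fun h x hx y hy => (h y hy x hx).symm, fun h x hx y hy => (h y hy x hx).symm⟩
  rw [IsCompatible, CactusRelated, CactusRelated, hprod, hprod, hsymm, parabolic_le_iff,
    parabolic_le_iff]
  tauto

/-- The longest element of `W_I` normalizes `W_J` if `γ_I` and `γ_J` are related. -/
theorem CactusRelated.conjBy_longest {I J : cs.ConnectedSubset} (h : cs.CactusRelated I.1 J.1) :
    conjBy (cs.longest I) (cs.parabolic J.1) = cs.parabolic J.1 := by
  rcases h with h | h
  · exact conjBy_eq_self_of_mem (cs.parabolic_mono h (cs.longest_mem I))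
  · exact conjBy_eq_self_of_forall_commute (h.2.1 _ (cs.longest_mem I))

/-- The connected subset `w_J(I)` exists if `γ_I` and `γ_J` are related. -/
theorem CactusRelated.exists_isConjSimple {I J : cs.ConnectedSubset}
    (h : cs.CactusRelated I.1 J.1) :
    ∃ K : cs.ConnectedSubset, cs.IsConjSimple (cs.longest J) I.1 K.1 := by
  rcases h with h | h
  · have hK : cs.IsConjSimple (cs.longest J) I.1
        {k | ∃ i ∈ I.1, cs.simple k = cs.longest J * cs.simple i * (cs.longest J)⁻¹} := by
      apply Set.Subset.antisymm
      · rintro _ ⟨k, ⟨i, hi, hk⟩, rfl⟩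
        exact ⟨_, ⟨i, hi, rfl⟩, hk.symm⟩
      · rintro _ ⟨_, ⟨i, hi, rfl⟩, rfl⟩
        obtain ⟨k, -, hk⟩ := (cs.isLongestIn_longest J).exists_conj_simple (h hi)
        exact ⟨k, ⟨i, hi, hk.symm⟩, hk.symm⟩
    exact ⟨⟨_, hK.isConnectedSubset I.2⟩, hK⟩
  -- In the product case `w_J` centralizes `W_I`, so `K = I`.
  · refine ⟨I, ?_⟩
    rw [IsConjSimple, Set.image_image]
    refine Set.image_congr fun i hi => ?_
    rw [← h.2.1 _ (simple_mem_parabolic hi) _ (cs.longest_mem J), mul_inv_cancel_right]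

end CoxeterSystem

namespace CoxeterSystem

open Subgroup

variable {B W : Type*} [Group W] {M : CoxeterMatrix B} (cs : CoxeterSystem M W)

/-! ### The right-angled Coxeter group -/

section RightAngled

/-- The generator `τ_H` of the right-angled Coxeter group. -/
noncomputable def rightAngledGen (H : cs.connectedParabolics) : cs.rightAngledMatrix.Group :=
  cs.rightAngledMatrix.simple H

theorem rightAngledGen_mul_self (H : cs.connectedParabolics) :
    cs.rightAngledGen H * cs.rightAngledGen H = 1 :=
  cs.rightAngledMatrix.toCoxeterSystem.simple_mul_simple_self H

open Classical in
theorem rightAngledMatrix_apply (H K : cs.connectedParabolics) :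
    cs.rightAngledMatrix H K =
      if H = K then 1 else if IsCompatible H.1 K.1 then 2 else 0 := by
  have hc : K.1 ≤ Subgroup.centralizer (H.1 : Set W) ↔
      ∀ h ∈ H.1, ∀ k ∈ K.1, h * k = k * h := by
    simp only [SetLike.le_def, Subgroup.mem_centralizer_iff, SetLike.mem_coe]
    exact ⟨fun h x hx y hy => h hy x hx, fun h y hy x hx => h x hx y hy⟩
  change (if H = K then 1
    else if H.1 ≤ K.1 ∨ K.1 ≤ H.1 then 2
    else if H.1 ⊓ K.1 = ⊥ ∧ K.1 ≤ Subgroup.centralizer (H.1 : Set W) then 2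
    else 0) = _
  simp only [hc, IsCompatible, ← or_assoc]
  split_ifs <;> tauto

theorem isLiftable_rightAngledMatrix {G : Type*} [Monoid G] {f : cs.connectedParabolics → G}
    (hsq : ∀ H, f H * f H = 1)
    (hcomm : ∀ H K, IsCompatible H.1 K.1 → f H * f K = f K * f H) :
    cs.rightAngledMatrix.IsLiftable f := by
  intro H K
  rw [rightAngledMatrix_apply]
  split_ifs with h1 h2
  · rw [h1, hsq, one_pow]
  · rw [pow_two, mul_assoc, ← mul_assoc (f K), ← hcomm H K h2, mul_assoc, hsq, mul_one, hsq]
  · rw [pow_zero]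

theorem rightAngledGen_comm {H K : cs.connectedParabolics} (h : IsCompatible H.1 K.1) :
    cs.rightAngledGen H * cs.rightAngledGen K = cs.rightAngledGen K * cs.rightAngledGen H := by
  rcases eq_or_ne H K with rfl | hne
  · rfl
  have h1 := cs.rightAngledMatrix.toCoxeterSystem.simple_mul_simple_pow H K
  rw [rightAngledMatrix_apply, if_neg hne, if_pos h, pow_two] at h1
  have h2 := eq_inv_of_mul_eq_one_left h1
  rwa [mul_inv_rev, inv_simple, inv_simple] at h2

/-- Lift a function on the generators of the right-angled Coxeter group to a homomorphism. -/
noncomputable def rightAngledLift {G : Type*} [Monoid G] (f : cs.connectedParabolics → G)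
    (hsq : ∀ H, f H * f H = 1)
    (hcomm : ∀ H K, IsCompatible H.1 K.1 → f H * f K = f K * f H) :
    cs.rightAngledMatrix.Group →* G :=
  cs.rightAngledMatrix.toCoxeterSystem.lift ⟨f, cs.isLiftable_rightAngledMatrix hsq hcomm⟩

@[simp]
theorem rightAngledLift_gen {G : Type*} [Monoid G] (f : cs.connectedParabolics → G)
    (hsq : ∀ H, f H * f H = 1)
    (hcomm : ∀ H K, IsCompatible H.1 K.1 → f H * f K = f K * f H) (H : cs.connectedParabolics) :
    cs.rightAngledLift f hsq hcomm (cs.rightAngledGen H) = f H :=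
  cs.rightAngledMatrix.toCoxeterSystem.lift_apply_simple _ H

/-- The action of `W` by conjugation on the conjugates of connected parabolic subgroups. -/
def conjParabolic (w : W) (H : cs.connectedParabolics) : cs.connectedParabolics :=
  ⟨conjBy w H.1, by
    obtain ⟨_, v, I, rfl⟩ := H
    exact ⟨w * v, I, (conjBy_mul w v _).symm⟩⟩

/-- The action of `W` on the right-angled Coxeter group, for a single element. -/
noncomputable def rightAngledConj (w : W) :
    cs.rightAngledMatrix.Group →* cs.rightAngledMatrix.Group :=
  cs.rightAngledLift (fun H => cs.rightAngledGen (cs.conjParabolic w H))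
    (fun _ => cs.rightAngledGen_mul_self _)
    (fun _ _ h => cs.rightAngledGen_comm (isCompatible_conjBy_iff.mpr h))

theorem rightAngledConj_gen (w : W) (H : cs.connectedParabolics) :
    cs.rightAngledConj w (cs.rightAngledGen H) = cs.rightAngledGen (cs.conjParabolic w H) :=
  cs.rightAngledLift_gen _ _ _ H

theorem rightAngledConj_mul (v w : W) :
    cs.rightAngledConj (v * w) = (cs.rightAngledConj v).comp (cs.rightAngledConj w) := by
  refine cs.rightAngledMatrix.toCoxeterSystem.ext_simple fun H => ?_
  change cs.rightAngledConj (v * w) (cs.rightAngledGen H) =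
    cs.rightAngledConj v (cs.rightAngledConj w (cs.rightAngledGen H))
  rw [rightAngledConj_gen, rightAngledConj_gen, rightAngledConj_gen]
  exact congrArg _ (Subtype.ext (conjBy_mul v w H.1))

theorem rightAngledConj_one : cs.rightAngledConj 1 = MonoidHom.id _ := by
  refine cs.rightAngledMatrix.toCoxeterSystem.ext_simple fun H => ?_
  change cs.rightAngledConj 1 (cs.rightAngledGen H) = cs.rightAngledGen H
  rw [rightAngledConj_gen]
  exact congrArg _ (Subtype.ext (conjBy_one H.1))

/-- The action of `W` on the right-angled Coxeter group. -/
noncomputable def rightAngledAut : W →* MulAut cs.rightAngledMatrix.Group where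
  toFun w := MonoidHom.toMulEquiv (cs.rightAngledConj w) (cs.rightAngledConj w⁻¹)
    (by rw [← rightAngledConj_mul, inv_mul_cancel, rightAngledConj_one])
    (by rw [← rightAngledConj_mul, mul_inv_cancel, rightAngledConj_one])
  map_one' := by
    ext x
    simp [rightAngledConj_one]
  map_mul' v w := by
    ext x
    simp [rightAngledConj_mul]

theorem rightAngledAut_gen (w : W) (H : cs.connectedParabolics) :
    cs.rightAngledAut w (cs.rightAngledGen H) = cs.rightAngledGen (cs.conjParabolic w H) :=
  cs.rightAngledConj_gen w H

end RightAngled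

/-! ### The cactus group -/

section Cactus

/-- The conjugate `w W_I w⁻¹` of the parabolic subgroup of a connected subset. -/
def conjOfConnected (w : W) (I : cs.ConnectedSubset) : cs.connectedParabolics :=
  ⟨conjBy w (cs.parabolic I.1), w, I, rfl⟩

theorem conjParabolic_conjOfConnected (v w : W) (I : cs.ConnectedSubset) :
    cs.conjParabolic v (cs.conjOfConnected w I) = cs.conjOfConnected (v * w) I :=
  Subtype.ext (conjBy_mul v w _).symm

theorem conjOfConnected_injective (w : W) : Function.Injective (cs.conjOfConnected w) :=
  fun _ _ h => Subtype.ext <| cs.parabolic_injective <|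
    conjBy_injective w (congrArg Subtype.val h)

theorem conjOfConnected_mul_longest_self (w : W) (I : cs.ConnectedSubset) :
    cs.conjOfConnected (w * cs.longest I) I = cs.conjOfConnected w I := by
  refine Subtype.ext ?_
  simp only [conjOfConnected]
  rw [conjBy_mul, conjBy_eq_self_of_mem (cs.longest_mem I)]

variable {cs} in
theorem CactusRelated.conjOfConnected_mul_longest {I J : cs.ConnectedSubset}
    (h : cs.CactusRelated I.1 J.1) (w : W) :
    cs.conjOfConnected (w * cs.longest I) J = cs.conjOfConnected w J := by
  refine Subtype.ext ?_
  simp only [conjOfConnected]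
  rw [conjBy_mul, h.conjBy_longest]

variable {cs} in
theorem IsConjSimple.conjOfConnected_mul_longest {I J K : cs.ConnectedSubset}
    (h : cs.IsConjSimple (cs.longest J) I.1 K.1) (w : W) :
    cs.conjOfConnected (w * cs.longest J) K = cs.conjOfConnected w I := by
  refine Subtype.ext ?_
  simp only [conjOfConnected]
  rw [h.parabolic_eq, ← conjBy_mul, mul_assoc, longest_mul_self, mul_one]

-- Uniqueness of the longest element is what makes the `W`-component satisfy the cactus relation.
variable {cs} in
theorem IsConjSimple.longest_eq {w : W} {I K : cs.ConnectedSubset}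
    (h : cs.IsConjSimple w I.1 K.1) : cs.longest K = w * cs.longest I * w⁻¹ :=
  (cs.isLongestIn_longest K).unique (h.isLongestIn (cs.isLongestIn_longest I))

theorem isCompatible_conjOfConnected {w : W} {I J : cs.ConnectedSubset} :
    IsCompatible (cs.conjOfConnected w I).1 (cs.conjOfConnected w J).1 ↔
      cs.CactusRelated I.1 J.1 ∨ cs.CactusRelated J.1 I.1 := by
  rw [conjOfConnected, conjOfConnected, isCompatible_conjBy_iff, isCompatible_iff_cactusRelated]

theorem cactusGen_mul_self (I : cs.ConnectedSubset) : cs.cactusGen I * cs.cactusGen I = 1 := by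
  have h : PresentedGroup.mk cs.cactusRelators (FreeGroup.of I ^ 2) = 1 :=
    PresentedGroup.one_of_mem (Or.inl ⟨I, rfl⟩)
  rwa [map_pow, pow_two] at h

theorem cactusGen_mul_cactusGen {I J K : cs.ConnectedSubset} (h : cs.CactusRelated I.1 J.1)
    (hK : cs.IsConjSimple (cs.longest J) I.1 K.1) :
    cs.cactusGen I * cs.cactusGen J = cs.cactusGen J * cs.cactusGen K := by
  have h : PresentedGroup.mk cs.cactusRelators
      (FreeGroup.of I * FreeGroup.of J * (FreeGroup.of J * FreeGroup.of K)⁻¹) = 1 :=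
    PresentedGroup.one_of_mem (Or.inr ⟨I, J, K, h, hK, rfl⟩)
  rw [map_mul, map_mul, map_inv, map_mul] at h
  exact mul_inv_eq_one.mp h

/-- The image of the generator `γ_I` in the semidirect product of the right-angled Coxeter group
and `W`. -/
noncomputable def semidirectGen (I : cs.ConnectedSubset) :
    cs.rightAngledMatrix.Group ⋊[cs.rightAngledAut] W :=
  ⟨cs.rightAngledGen (cs.conjOfConnected 1 I), cs.longest I⟩

theorem semidirectGen_mul_self (I : cs.ConnectedSubset) :
    cs.semidirectGen I * cs.semidirectGen I = 1 := by
  refine SemidirectProduct.ext ?_ ?_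
  · simp only [semidirectGen, SemidirectProduct.mul_left, SemidirectProduct.one_left]
    rw [rightAngledAut_gen, conjParabolic_conjOfConnected, mul_one, ← one_mul (cs.longest I),
      conjOfConnected_mul_longest_self, rightAngledGen_mul_self]
  · exact cs.longest_mul_self I

theorem semidirectGen_mul_semidirectGen {I J K : cs.ConnectedSubset}
    (h : cs.CactusRelated I.1 J.1) (hK : cs.IsConjSimple (cs.longest J) I.1 K.1) :
    cs.semidirectGen I * cs.semidirectGen J = cs.semidirectGen J * cs.semidirectGen K := by
  refine SemidirectProduct.ext ?_ ?_
  · simp only [semidirectGen, SemidirectProduct.mul_left]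
    rw [rightAngledAut_gen, rightAngledAut_gen, conjParabolic_conjOfConnected,
      conjParabolic_conjOfConnected, mul_one, mul_one, ← one_mul (cs.longest I),
      ← one_mul (cs.longest J), h.conjOfConnected_mul_longest, hK.conjOfConnected_mul_longest]
    exact cs.rightAngledGen_comm (cs.isCompatible_conjOfConnected.mpr (Or.inl h))
  · simp only [semidirectGen, SemidirectProduct.mul_right]
    rw [hK.longest_eq, inv_longest, mul_assoc, ← mul_assoc, longest_mul_self, one_mul]

/-- The homomorphism from the cactus group to the semidirect product of the right-angled Coxeter
group and `W`. -/
noncomputable def cactusToSemidirect :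
    cs.CactusGroup →* cs.rightAngledMatrix.Group ⋊[cs.rightAngledAut] W :=
  PresentedGroup.toGroup (f := cs.semidirectGen) <| by
    rintro _ (⟨I, rfl⟩ | ⟨I, J, K, h, hK, rfl⟩)
    · rw [map_pow, FreeGroup.lift_apply_of, pow_two, semidirectGen_mul_self]
    · rw [map_mul, map_mul, map_inv, map_mul, FreeGroup.lift_apply_of, FreeGroup.lift_apply_of,
        FreeGroup.lift_apply_of, mul_inv_eq_one]
      exact cs.semidirectGen_mul_semidirectGen h hK

theorem cactusToSemidirect_gen (I : cs.ConnectedSubset) :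
    cs.cactusToSemidirect (cs.cactusGen I) = cs.semidirectGen I :=
  PresentedGroup.toGroup.of _

/-- The homomorphism `g_W` from the cactus group to the Coxeter group. -/
noncomputable def cactusToCoxeter : cs.CactusGroup →* W :=
  SemidirectProduct.rightHom.comp cs.cactusToSemidirect

theorem cactusToCoxeter_gen (I : cs.ConnectedSubset) :
    cs.cactusToCoxeter (cs.cactusGen I) = cs.longest I := by
  rw [cactusToCoxeter, MonoidHom.comp_apply, cactusToSemidirect_gen]
  rfl

theorem right_cactusToSemidirect (y : cs.CactusGroup) :
    (cs.cactusToSemidirect y).right = cs.cactusToCoxeter y := rfl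

/-! ### The action of the right-angled Coxeter group on the cactus group -/

open Classical in
/-- The action of `τ_H` on the cactus group: it maps `y` to `y γ_I` if `H = g_W(y) W_I g_W(y)⁻¹`,
and fixes `y` if there is no such `I`. -/
noncomputable def cactusAct (H : cs.connectedParabolics) : Function.End cs.CactusGroup := fun y =>
  if h : ∃ I, cs.conjOfConnected (cs.cactusToCoxeter y) I = H then
    y * cs.cactusGen h.choose
  else y

theorem cactusAct_conjOfConnected (y : cs.CactusGroup) (I : cs.ConnectedSubset) :
    cs.cactusAct (cs.conjOfConnected (cs.cactusToCoxeter y) I) y = y * cs.cactusGen I := by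
  have h : ∃ J, cs.conjOfConnected (cs.cactusToCoxeter y) J =
    cs.conjOfConnected (cs.cactusToCoxeter y) I := ⟨I, rfl⟩
  rw [cactusAct, dif_pos h, cs.conjOfConnected_injective _ h.choose_spec]

theorem cactusAct_of_eq {y : cs.CactusGroup} {I : cs.ConnectedSubset}
    {H : cs.connectedParabolics} (h : cs.conjOfConnected (cs.cactusToCoxeter y) I = H) :
    cs.cactusAct H y = y * cs.cactusGen I := by
  rw [← h, cactusAct_conjOfConnected]

theorem cactusAct_of_not_exists {y : cs.CactusGroup} {H : cs.connectedParabolics}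
    (h : ¬ ∃ I, cs.conjOfConnected (cs.cactusToCoxeter y) I = H) : cs.cactusAct H y = y :=
  dif_neg h

theorem conjOfConnected_mul_cactusGen (y : cs.CactusGroup) (I J : cs.ConnectedSubset) :
    cs.conjOfConnected (cs.cactusToCoxeter (y * cs.cactusGen I)) J =
      cs.conjOfConnected (cs.cactusToCoxeter y * cs.longest I) J := by
  rw [map_mul, cactusToCoxeter_gen]

theorem cactusAct_mul_self (H : cs.connectedParabolics) :
    cs.cactusAct H * cs.cactusAct H = 1 := by
  funext y
  rw [Function.End.mul_apply]
  by_cases h : ∃ I, cs.conjOfConnected (cs.cactusToCoxeter y) I = H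
  · obtain ⟨I, hI⟩ := h
    rw [cs.cactusAct_of_eq hI, cs.cactusAct_of_eq (I := I), mul_assoc, cactusGen_mul_self, mul_one]
    · rfl
    · rw [conjOfConnected_mul_cactusGen, conjOfConnected_mul_longest_self, hI]
  · rw [cs.cactusAct_of_not_exists h, cs.cactusAct_of_not_exists h]
    rfl

variable {cs} in
/-- If both `τ_H` and `τ_K` move `y` and `γ_I`, `γ_J` are related, then the actions commute. -/
theorem CactusRelated.cactusAct_comm {I J : cs.ConnectedSubset} (h : cs.CactusRelated I.1 J.1)
    (y : cs.CactusGroup) {H K : cs.connectedParabolics}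
    (hI : cs.conjOfConnected (cs.cactusToCoxeter y) I = H)
    (hJ : cs.conjOfConnected (cs.cactusToCoxeter y) J = K) :
    (∃ J', cs.conjOfConnected (cs.cactusToCoxeter (y * cs.cactusGen I)) J' = K) ∧
    (∃ I', cs.conjOfConnected (cs.cactusToCoxeter (y * cs.cactusGen J)) I' = H) ∧
    cs.cactusAct H (cs.cactusAct K y) = cs.cactusAct K (cs.cactusAct H y) := by
  obtain ⟨I', hI'⟩ := h.exists_isConjSimple
  have h1 : cs.conjOfConnected (cs.cactusToCoxeter (y * cs.cactusGen I)) J = K := by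
    rw [conjOfConnected_mul_cactusGen, h.conjOfConnected_mul_longest, hJ]
  have h2 : cs.conjOfConnected (cs.cactusToCoxeter (y * cs.cactusGen J)) I' = H := by
    rw [conjOfConnected_mul_cactusGen, hI'.conjOfConnected_mul_longest, hI]
  refine ⟨⟨J, h1⟩, ⟨I', h2⟩, ?_⟩
  rw [cs.cactusAct_of_eq hI, cs.cactusAct_of_eq hJ, cs.cactusAct_of_eq h1, cs.cactusAct_of_eq h2,
    mul_assoc, mul_assoc, cs.cactusGen_mul_cactusGen h hI']

theorem exists_conjOfConnected_mul_cactusGen {y : cs.CactusGroup} {H K : cs.connectedParabolics}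
    (hc : IsCompatible H.1 K.1) {I : cs.ConnectedSubset}
    (hI : cs.conjOfConnected (cs.cactusToCoxeter y) I = H)
    (hK : ∃ J, cs.conjOfConnected (cs.cactusToCoxeter y) J = K) :
    ∃ J, cs.conjOfConnected (cs.cactusToCoxeter (y * cs.cactusGen I)) J = K := by
  obtain ⟨J, hJ⟩ := hK
  have hc' := hc
  rw [← hI, ← hJ, isCompatible_conjOfConnected] at hc'
  rcases hc' with h | h
  · exact (h.cactusAct_comm y hI hJ).1
  · exact (h.cactusAct_comm y hJ hI).2.1

theorem cactusAct_comm_of_not_exists {y : cs.CactusGroup} {H K : cs.connectedParabolics}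
    (hc : IsCompatible H.1 K.1)
    (hK : ¬ ∃ J, cs.conjOfConnected (cs.cactusToCoxeter y) J = K) :
    cs.cactusAct H (cs.cactusAct K y) = cs.cactusAct K (cs.cactusAct H y) := by
  rw [cs.cactusAct_of_not_exists hK]
  by_cases hH : ∃ I, cs.conjOfConnected (cs.cactusToCoxeter y) I = H
  · obtain ⟨I, hI⟩ := hH
    rw [cs.cactusAct_of_eq hI, cs.cactusAct_of_not_exists]
    intro hK'
    -- The transfer lemma is applied at `y γ_I`, from which `γ_I` leads back to `y`.
    have hI' : cs.conjOfConnected (cs.cactusToCoxeter (y * cs.cactusGen I)) I = H := by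
      rw [conjOfConnected_mul_cactusGen, conjOfConnected_mul_longest_self, hI]
    have := cs.exists_conjOfConnected_mul_cactusGen hc hI' hK'
    rw [mul_assoc, cactusGen_mul_self, mul_one] at this
    exact hK this
  · rw [cs.cactusAct_of_not_exists hH, cs.cactusAct_of_not_exists hK]

theorem cactusAct_comm {H K : cs.connectedParabolics} (hc : IsCompatible H.1 K.1) :
    cs.cactusAct H * cs.cactusAct K = cs.cactusAct K * cs.cactusAct H := by
  funext y
  rw [Function.End.mul_apply, Function.End.mul_apply]
  by_cases hK : ∃ J, cs.conjOfConnected (cs.cactusToCoxeter y) J = K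
  · by_cases hH : ∃ I, cs.conjOfConnected (cs.cactusToCoxeter y) I = H
    · obtain ⟨I, hI⟩ := hH
      obtain ⟨J, hJ⟩ := hK
      rw [← hI, ← hJ, isCompatible_conjOfConnected] at hc
      rcases hc with h | h
      · exact (h.cactusAct_comm y hI hJ).2.2
      · exact (h.cactusAct_comm y hJ hI).2.2.symm
    · exact (cs.cactusAct_comm_of_not_exists hc.symm hH).symm
  · exact cs.cactusAct_comm_of_not_exists hc hK

/-- The action of the right-angled Coxeter group on the set underlying the cactus group. -/
noncomputable def cactusActHom :
    cs.rightAngledMatrix.Group →* Function.End cs.CactusGroup :=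
  cs.rightAngledLift cs.cactusAct cs.cactusAct_mul_self fun _ _ => cs.cactusAct_comm

/-- An element of the cactus group is recovered from its component in the right-angled Coxeter
group by acting on the identity. -/
theorem cactusActHom_left_inv_one (y : cs.CactusGroup) :
    cs.cactusActHom (cs.cactusToSemidirect y).left⁻¹ 1 = y := by
  have step : ∀ (y : cs.CactusGroup) (I : cs.ConnectedSubset),
      cs.cactusActHom (cs.cactusToSemidirect y).left⁻¹ 1 = y →
      cs.cactusActHom (cs.cactusToSemidirect (y * cs.cactusGen I)).left⁻¹ 1 =
        y * cs.cactusGen I := by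
    intro y I ih
    have hinv : (cs.rightAngledGen (cs.conjOfConnected (cs.cactusToCoxeter y) I))⁻¹ =
        cs.rightAngledGen (cs.conjOfConnected (cs.cactusToCoxeter y) I) :=
      inv_eq_of_mul_eq_one_right (cs.rightAngledGen_mul_self _)
    rw [map_mul, cactusToSemidirect_gen, SemidirectProduct.mul_left, right_cactusToSemidirect]
    simp only [semidirectGen]
    -- Inversion reverses the product, so the new generator acts last, on `y`; its index is `W_I`
    -- conjugated by `g_W(y)`, exactly the one that appends `γ_I`.
    rw [rightAngledAut_gen, conjParabolic_conjOfConnected, mul_one, mul_inv_rev, map_mul,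
      Function.End.mul_apply, ih, hinv, cactusActHom, rightAngledLift_gen,
      cactusAct_conjOfConnected]
  have hy : y ∈ Subgroup.closure (Set.range cs.cactusGen) := by
    have : Subgroup.closure (Set.range cs.cactusGen) = ⊤ :=
      PresentedGroup.closure_range_of cs.cactusRelators
    rw [this]
    exact Subgroup.mem_top y
  induction hy using Subgroup.closure_induction_right with
  | one => simp [Function.End.one_def]
  | mul_right x hx y hy ih =>
    obtain ⟨I, rfl⟩ := hy
    exact step x I ih
  | mul_inv_cancel x hx y hy ih =>
    obtain ⟨I, rfl⟩ := hy
    rw [inv_eq_of_mul_eq_one_right (cs.cactusGen_mul_self I)]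
    exact step x I ih

/-- The homomorphism from the pure cactus group to the right-angled Coxeter group. -/
noncomputable def pureCactusToRightAngled :
    cs.cactusToCoxeter.ker →* cs.rightAngledMatrix.Group where
  toFun y := (cs.cactusToSemidirect y).left
  map_one' := by simp
  map_mul' x y := by
    -- On the kernel the `W`-component is trivial, so the twist in the semidirect multiplication
    -- disappears.
    have hx : (cs.cactusToSemidirect x).right = 1 := x.2
    simp [hx]

theorem pureCactusToRightAngled_injective :
    Function.Injective cs.pureCactusToRightAngled := by
  intro x y h
  have h' : (cs.cactusToSemidirect x).left = (cs.cactusToSemidirect y).left := h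
  refine Subtype.ext ?_
  rw [← cs.cactusActHom_left_inv_one x, h', cs.cactusActHom_left_inv_one y]

end Cactus

end CoxeterSystem

theorem theorem1 {B W : Type*} [Group W] {M : CoxeterMatrix B} (cs : CoxeterSystem M W) :
    ∃ g : cs.CactusGroup →* W,
      (∀ I : cs.ConnectedSubset, g (cs.cactusGen I) = cs.longest I) ∧
      ∃ f : g.ker →* cs.rightAngledMatrix.Group, Function.Injective f :=
  ⟨cs.cactusToCoxeter, cs.cactusToCoxeter_gen, cs.pureCactusToRightAngled,
    cs.pureCactusToRightAngled_injective⟩
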